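/- Let $\mathcal{N}^{*}$ be the set of all real numbers $L>0$ for which there exists $(a,b)\in\mathbb{C}^2$ such that $$a e^{a}=b e^{b}=-(a+b)e^{-(a+b)}\quad\text{and}\quad L^2=-(a^2+ab+b^2),$$ and let $\mathcal{N}^{\dagger}$ be the set of all real numbers $L>0$ for which there exists $(a,b)\in\mathbb{C}^2$ such that $$a^{2} e^{a}=b^{2} e^{b}=(a+b)^{2}e^{-(a+b)}\quad\text{and}\quad L^2=-(a^2+ab+b^2).$$ Then $\mathcal{N}^{\dagger}$ is countable and non-empty. Moreover, if $L\in\mathcal{N}^{*}$, then $2L\in\mathcal{N}^{\dagger}$. -/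

import Mathlib

/-- The set `𝒩*` of lengths `L > 0` such that, for some `(a, b) ∈ ℂ²`,
`a eᵃ = b eᵇ = -(a + b) e^{-(a + b)}` and `L² = -(a² + a b + b²)`. -/
def criticalSetStar : Set ℝ :=
  {L : ℝ | 0 < L ∧ ∃ a b : ℂ,
    a * Complex.exp a = b * Complex.exp b ∧
    b * Complex.exp b = -(a + b) * Complex.exp (-(a + b)) ∧
    (L : ℂ) ^ 2 = -(a ^ 2 + a * b + b ^ 2)}

/-- The set `𝒩†` of lengths `L > 0` such that, for some `(a, b) ∈ ℂ²`,
`a² eᵃ = b² eᵇ = (a + b)² e^{-(a + b)}` and `L² = -(a² + a b + b²)`. -/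
def criticalSetDagger : Set ℝ :=
  {L : ℝ | 0 < L ∧ ∃ a b : ℂ,
    a ^ 2 * Complex.exp a = b ^ 2 * Complex.exp b ∧
    b ^ 2 * Complex.exp b = (a + b) ^ 2 * Complex.exp (-(a + b)) ∧
    (L : ℂ) ^ 2 = -(a ^ 2 + a * b + b ^ 2)}

/-! Doubling `(a, b)` turns the dagger equations into the squares of the star equations, up to a
factor 4. Non-emptiness comes from a conjugate pair `a`, `b` with `c = -(a + b) = 2u` real: modulus
and argument give two real equations, solved by the intermediate value theorem. For countability,
solutions with `s = L² > 0` are isolated zeros of `daggerMap`, hence form a discrete subset of `ℂ ×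
ℂ`. Its Jacobian vanishes only if `4s + 3abc = 0`; then `a, b, c` are the roots of a real cubic with
a negative root, which a comparison of sizes excludes. -/

theorem two_mul_mem_criticalSetDagger {L : ℝ} (hL : L ∈ criticalSetStar) :
    2 * L ∈ criticalSetDagger := by
  obtain ⟨hpos, a, b, h₁, h₂, hs⟩ := hL
  refine ⟨by positivity, 2 * a, 2 * b, ?_, ?_, ?_⟩
  · rw [two_mul a, two_mul b, Complex.exp_add, Complex.exp_add]
    linear_combination 4 * (a * Complex.exp a + b * Complex.exp b) * h₁
  · rw [show -(2 * a + 2 * b) = -(a + b) + -(a + b) by ring, two_mul b, Complex.exp_add,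
      Complex.exp_add]
    linear_combination 4 * (b * Complex.exp b + -(a + b) * Complex.exp (-(a + b))) * h₂
  · push_cast
    linear_combination 4 * hs

/-- A real solution `u > 0` of the equation satisfied by the symmetric family
`a = -u + i y`, `b = -u - i y` with `y = u √(4 e^{3u} - 1)`. -/
theorem exists_symmetric_solution :
    ∃ u y : ℝ, 0 < u ∧ y ^ 2 = u ^ 2 * (4 * Real.exp (3 * u) - 1) ∧
      y * Real.cos (y / 2) = u * Real.sin (y / 2) := by
  set Y : ℝ → ℝ := fun u => u * √(4 * Real.exp (3 * u) - 1) with hY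
  have hYc : Continuous Y := by fun_prop
  have hroot : ∀ u : ℝ, 0 ≤ u → 1 ≤ √(4 * Real.exp (3 * u) - 1) := by
    intro u hu
    rw [Real.one_le_sqrt]
    have := Real.one_le_exp (show 0 ≤ 3 * u by positivity)
    linarith
  have hsurj : ∀ t : ℝ, 0 < t → ∃ u, 0 < u ∧ Y u = t := by
    intro t ht
    have h0 : Y 0 = 0 := by simp [hY]
    have h1 : t ≤ Y t := le_mul_of_one_le_right ht.le (hroot t ht.le)
    obtain ⟨u, hu, hut⟩ := intermediate_value_Icc ht.le hYc.continuousOn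
      (show t ∈ Set.Icc (Y 0) (Y t) from ⟨by rw [h0]; exact ht.le, h1⟩)
    refine ⟨u, lt_of_le_of_ne hu.1 ?_, hut⟩
    rintro rfl
    rw [h0] at hut
    exact ht.ne hut
  -- At these values of `Y` the sine term vanishes and the cosine is `-1`, then `1`, so `f` changes
  -- sign.
  obtain ⟨u₁, hu₁, h₁⟩ := hsurj (2 * Real.pi) (by positivity)
  obtain ⟨u₂, hu₂, h₂⟩ := hsurj (4 * Real.pi) (by positivity)
  set f : ℝ → ℝ := fun u => Y u * Real.cos (Y u / 2) - u * Real.sin (Y u / 2) with hf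
  have hfc : Continuous f := by fun_prop
  have hf₁ : f u₁ ≤ 0 := by
    simp only [hf, h₁]
    rw [show 2 * Real.pi / 2 = Real.pi by ring, Real.cos_pi, Real.sin_pi]
    linarith [Real.pi_pos]
  have hf₂ : 0 ≤ f u₂ := by
    simp only [hf, h₂]
    rw [show 4 * Real.pi / 2 = 2 * Real.pi by ring, Real.cos_two_pi, Real.sin_two_pi]
    linarith [Real.pi_pos]
  obtain ⟨u, hu, hfu⟩ := intermediate_value_uIcc hfc.continuousOn
    (show (0 : ℝ) ∈ Set.uIcc (f u₁) (f u₂) from Set.Icc_subset_uIcc ⟨hf₁, hf₂⟩)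
  have hupos : 0 < u := lt_of_lt_of_le (lt_min hu₁ hu₂) hu.1
  refine ⟨u, Y u, hupos, ?_, by simpa only [hf, sub_eq_zero] using hfu⟩
  have := hroot u hupos.le
  rw [Real.one_le_sqrt] at this
  rw [hY, mul_pow, Real.sq_sqrt (by linarith)]

-- The left side is `e^{-u}` times the square of `(-u + iy)e^{iy/2}`. By `h` that number is real; by
-- `hy` its squared modulus is `4u²e^{3u}`.
open Complex in
theorem sq_mul_exp_of_symmetric {u y : ℝ} (hy : y ^ 2 = u ^ 2 * (4 * Real.exp (3 * u) - 1))
    (h : y * Real.cos (y / 2) = u * Real.sin (y / 2)) :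
    (-(u : ℂ) + y * I) ^ 2 * exp (-(u : ℂ) + y * I) = (2 * u) ^ 2 * exp (2 * u) := by
  have hexp : exp (-(u : ℂ) + y * I)
      = exp (-u) * (Real.cos (y / 2) + Real.sin (y / 2) * I) ^ 2 := by
    rw [ofReal_cos, ofReal_sin, ← exp_mul_I, ← exp_nat_mul, ← exp_add]
    congr 1
    push_cast
    ring
  have hreal : (-(u : ℂ) + y * I) * (Real.cos (y / 2) + Real.sin (y / 2) * I)
      = ((-u * Real.cos (y / 2) - y * Real.sin (y / 2) : ℝ) : ℂ) := by
    have h' : (y : ℂ) * Real.cos (y / 2) = u * Real.sin (y / 2) := by exact_mod_cast h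
    push_cast at h' ⊢
    linear_combination I * h' + y * Complex.sin (y / 2) * I_sq
  have hsq : (-u * Real.cos (y / 2) - y * Real.sin (y / 2)) ^ 2
      = 4 * u ^ 2 * Real.exp (3 * u) := by
    linear_combination (u ^ 2 + y ^ 2) * Real.sin_sq_add_cos_sq (y / 2) + hy
      - (y * Real.cos (y / 2) - u * Real.sin (y / 2)) * h
  rw [hexp, mul_left_comm, ← mul_pow, hreal, ← ofReal_pow, hsq]
  push_cast
  rw [mul_left_comm, ← exp_add, show -(u : ℂ) + 3 * u = 2 * u by ring]
  ring

open Complex in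
theorem criticalSetDagger_nonempty : criticalSetDagger.Nonempty := by
  obtain ⟨u, y, hu, hy, h⟩ := exists_symmetric_solution
  have h₁ := sq_mul_exp_of_symmetric hy h
  have h₂ := sq_mul_exp_of_symmetric (u := u) (y := -y) (by rw [neg_sq, hy])
    (by rw [neg_div, Real.cos_neg, Real.sin_neg]; linarith)
  have hpos : 0 < y ^ 2 - 3 * u ^ 2 := by
    have := Real.one_lt_exp_iff.2 (show 0 < 3 * u by positivity)
    rw [hy]
    nlinarith [pow_pos hu 2]
  refine ⟨√(y ^ 2 - 3 * u ^ 2), Real.sqrt_pos.2 hpos, -(u : ℂ) + y * I, -(u : ℂ) + (-y : ℝ) * I,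
    h₁.trans h₂.symm, h₂.trans ?_, ?_⟩
  · rw [show -(-(u : ℂ) + y * I + (-(u : ℂ) + (-y : ℝ) * I)) = 2 * u by push_cast; ring]
    push_cast
    ring
  · rw [← ofReal_pow, Real.sq_sqrt hpos.le]
    push_cast
    linear_combination (y ^ 2 : ℂ) * I_sq

open Complex in
/-- Two numbers `a`, `b` whose sum is `-t` and which satisfy the equations together with a real
number `t < 0` cannot have `a b - t²` real and positive. -/
theorem not_sq_mul_exp_eq_of_neg {a b : ℂ} {s t : ℝ} (hs : 0 < s) (ht : t < 0)
    (hsum : a + b = -t) (hprod : a * b = s + t ^ 2)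
    (ha : a ^ 2 * exp a = t ^ 2 * exp t) (hb : b ^ 2 * exp b = t ^ 2 * exp t) : False := by
  -- Product of `ha` and `hb`. For `t < 0` the left side exceeds `t⁴` and the right side is below
  -- it.
  have h : (s + t ^ 2 : ℂ) ^ 2 * exp (-t) = (t ^ 2 * exp t) ^ 2 := by
    rw [← hprod, ← hsum, exp_add]
    linear_combination b ^ 2 * exp b * ha + t ^ 2 * exp t * hb
  have h' : (s + t ^ 2) ^ 2 * Real.exp (-t) = (t ^ 2 * Real.exp t) ^ 2 := by exact_mod_cast h
  have e₁ : 1 < Real.exp (-t) := Real.one_lt_exp_iff.2 (by linarith)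
  have e₂ : Real.exp t < 1 := Real.exp_lt_one_iff.mpr ht
  have ht2 : 0 < t ^ 2 := sq_pos_of_neg ht
  have h₁ : (t ^ 2 * Real.exp t) ^ 2 < (t ^ 2) ^ 2 :=
    pow_lt_pow_left₀ (mul_lt_of_lt_one_right ht2 e₂) (by positivity) two_ne_zero
  have h₂ : (t ^ 2) ^ 2 < (s + t ^ 2) ^ 2 :=
    pow_lt_pow_left₀ (by linarith) ht2.le two_ne_zero
  have h₃ : (s + t ^ 2) ^ 2 < (s + t ^ 2) ^ 2 * Real.exp (-t) :=
    lt_mul_of_one_lt_right (by positivity) e₁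
  linarith

open Complex in
/-- At a solution with `L² = s > 0`, the Jacobian does not degenerate. -/
theorem four_mul_add_three_mul_ne_zero {a b c : ℂ} {s : ℝ} (hs : 0 < s) (hsum : a + b + c = 0)
    (he : a * b + b * c + c * a = s) (hab : a ^ 2 * exp a = b ^ 2 * exp b)
    (hbc : b ^ 2 * exp b = c ^ 2 * exp c) : 4 * (s : ℂ) + 3 * (a * b * c) ≠ 0 := by
  intro h
  -- By Vieta, `a, b, c` are the roots of this cubic. At `-4/3` the terms in `s` cancel.
  obtain ⟨t, ht, hroot⟩ : ∃ t : ℝ, t < 0 ∧ t ^ 3 + s * t + 4 * s / 3 = 0 := by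
    have hc : Continuous fun t : ℝ => t ^ 3 + s * t + 4 * s / 3 := by fun_prop
    obtain ⟨t, ht, h0⟩ := intermediate_value_Icc (show (-4 / 3 : ℝ) ≤ 0 by norm_num)
      hc.continuousOn (show (0 : ℝ) ∈ Set.Icc _ _ from ⟨by nlinarith, by simp; positivity⟩)
    refine ⟨t, lt_of_le_of_ne ht.2 ?_, h0⟩
    rintro rfl
    simp at h0
    exact hs.ne' h0
  have hroot' : (t : ℂ) ^ 3 + s * t + 4 * s / 3 = 0 := by exact_mod_cast hroot
  have hfac : ((t : ℂ) - a) * ((t - b) * (t - c)) = 0 := by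
    linear_combination hroot' - (t : ℂ) ^ 2 * hsum + t * he - h / 3
  rcases mul_eq_zero.1 hfac with h0 | h0
  · obtain rfl := sub_eq_zero.1 h0
    exact not_sq_mul_exp_eq_of_neg (a := b) (b := c) hs ht (by linear_combination hsum)
      (by linear_combination he - t * hsum) hab.symm (hbc.symm.trans hab.symm)
  rcases mul_eq_zero.1 h0 with h0 | h0
  · obtain rfl := sub_eq_zero.1 h0
    exact not_sq_mul_exp_eq_of_neg (a := a) (b := c) hs ht (by linear_combination hsum)
      (by linear_combination he - t * hsum) hab hbc.symm
  · obtain rfl := sub_eq_zero.1 h0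
    exact not_sq_mul_exp_eq_of_neg (a := a) (b := b) hs ht (by linear_combination hsum)
      (by linear_combination he - t * hsum) (hab.trans hbc) hbc

/-- Cramer's rule: `AB + BC + CA` is the determinant of the system. -/
theorem eq_zero_of_mul_eq_of_mul_add_eq_zero {A B C h k : ℂ} (hD : A * B + B * C + C * A ≠ 0)
    (h₁ : A * h - B * k = 0) (h₂ : B * k + C * (h + k) = 0) : h = 0 ∧ k = 0 := by
  constructor
  · refine (mul_eq_zero.1 ?_).resolve_left hD
    linear_combination (B + C) * h₁ + B * h₂
  · refine (mul_eq_zero.1 ?_).resolve_left hD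
    linear_combination A * h₂ - C * h₁

/-- The map whose zeros are the pairs `(a, b)` in the definition of `𝒩†`. -/
noncomputable def daggerMap (p : ℂ × ℂ) : ℂ × ℂ :=
  (p.1 ^ 2 * Complex.exp p.1 - p.2 ^ 2 * Complex.exp p.2,
    p.2 ^ 2 * Complex.exp p.2 - (p.1 + p.2) ^ 2 * Complex.exp (-(p.1 + p.2)))

/-- The zeros of `daggerMap` for which `-(a² + a b + b²)` is real and positive. -/
def daggerPairs : Set (ℂ × ℂ) :=
  {p | daggerMap p = 0 ∧ ∃ s : ℝ, 0 < s ∧ (s : ℂ) = -(p.1 ^ 2 + p.1 * p.2 + p.2 ^ 2)}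

open Complex in
theorem hasFDerivAt_sq_mul_exp {f : ℂ × ℂ → ℂ} {f' : ℂ × ℂ →L[ℂ] ℂ} {p : ℂ × ℂ}
    (hf : HasFDerivAt f f' p) :
    HasFDerivAt (fun q => f q ^ 2 * exp (f q)) (((2 * f p + f p ^ 2) * exp (f p)) • f') p := by
  have h : HasDerivAt (fun z : ℂ => z ^ 2 * exp z) ((2 * f p + f p ^ 2) * exp (f p)) (f p) := by
    refine (((hasDerivAt_id (f p)).pow 2).mul (Complex.hasDerivAt_exp (f p))).congr_deriv ?_
    simp
    ring
  exact h.comp_hasFDerivAt p hf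

theorem eventually_ne_of_hasFDerivAt {E F : Type*} [NormedAddCommGroup E] [NormedSpace ℂ E]
    [FiniteDimensional ℂ E] [NormedAddCommGroup F] [NormedSpace ℂ F] {f : E → F} {f' : E →L[ℂ] F}
    {x : E} (hf : HasFDerivAt f f' x) (hf' : ∀ v, f' v = 0 → v = 0) (c : F) :
    ∀ᶠ z in nhdsWithin x {x}ᶜ, f z ≠ c := by
  obtain ⟨K, -, hK⟩ := f'.toLinearMap.exists_antilipschitzWith (LinearMap.ker_eq_bot'.2 hf')
  exact hf.eventually_ne ⟨K, hK⟩

open Complex in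
theorem eventually_daggerMap_ne_zero {p : ℂ × ℂ} (hp : p ∈ daggerPairs) :
    ∀ᶠ q in nhdsWithin p {p}ᶜ, daggerMap q ≠ 0 := by
  obtain ⟨a, b⟩ := p
  obtain ⟨h0, s, hs, hL⟩ := hp
  simp only [daggerMap, Prod.mk_eq_zero, sub_eq_zero] at h0 hL
  obtain ⟨hab, hbc⟩ := h0
  obtain ⟨c, hc⟩ : ∃ c, c = -(a + b) := ⟨_, rfl⟩
  rw [← hc, show (a + b) ^ 2 = c ^ 2 by rw [hc]; ring] at hbc
  have hsum : a + b + c = 0 := by rw [hc]; ring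
  have he : a * b + b * c + c * a = s := by rw [hL, hc]; ring
  have hne := four_mul_add_three_mul_ne_zero hs hsum he hab hbc
  have hb : b ≠ 0 := by
    rintro rfl
    have ha : a = 0 := by simpa using hab
    subst ha
    have hs0 : (s : ℂ) = 0 := by rw [hL]; ring
    exact hs.ne' (by exact_mod_cast hs0)
  have hD : (2 * a + a ^ 2) * exp a * ((2 * b + b ^ 2) * exp b)
      + (2 * b + b ^ 2) * exp b * ((2 * c + c ^ 2) * exp c)
      + (2 * c + c ^ 2) * exp c * ((2 * a + a ^ 2) * exp a) ≠ 0 := by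
    intro hD
    -- With `w` the common value of `z²e^z`, each factor `(2z + z²)e^z` is `w(1 + 2/z)`; expand and
    -- multiply by `abc`.
    have hw : (b ^ 2 * exp b) ^ 2 * (4 * s + 3 * (a * b * c)) = 0 := by
      linear_combination a * b * c * hD
        - (c * (2 + a) * (2 + b) * (b ^ 2 * exp b) + b * (2 + c) * (2 + a) * (c ^ 2 * exp c)) * hab
        + (a * (2 + b) * (2 + c) + b * (2 + c) * (2 + a)) * (b ^ 2 * exp b) * hbc
        - 4 * (b ^ 2 * exp b) ^ 2 * (hsum + he)
    exact mul_ne_zero (pow_ne_zero 2 (mul_ne_zero (pow_ne_zero 2 hb) (exp_ne_zero b))) hne hw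
  have hd₁ := hasFDerivAt_sq_mul_exp (hasFDerivAt_fst (𝕜 := ℂ) (p := (a, b)))
  have hd₂ := hasFDerivAt_sq_mul_exp (hasFDerivAt_snd (𝕜 := ℂ) (p := (a, b)))
  have hd₃ := hasFDerivAt_sq_mul_exp ((hasFDerivAt_fst (𝕜 := ℂ) (p := (a, b))).add
    (hasFDerivAt_snd (𝕜 := ℂ) (p := (a, b)))).neg
  have hd := (hd₁.sub hd₂).prodMk (hd₂.sub hd₃)
  have hmap : daggerMap = fun q : ℂ × ℂ => (q.1 ^ 2 * exp q.1 - q.2 ^ 2 * exp q.2,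
      q.2 ^ 2 * exp q.2 - (-(q.1 + q.2)) ^ 2 * exp (-(q.1 + q.2))) := by
    funext q
    rw [daggerMap, neg_sq]
  rw [hmap]
  refine eventually_ne_of_hasFDerivAt hd ?_ 0
  rintro ⟨h, k⟩ hhk
  obtain ⟨e₁, e₂⟩ := Prod.mk_eq_zero.1 hhk
  have := eq_zero_of_mul_eq_of_mul_add_eq_zero (h := h) (k := k) hD (by simpa using e₁) ?_
  · exact Prod.mk_eq_zero.2 this
  · rw [show c = -b + -a by rw [hc]; ring]
    simp at e₂
    linear_combination e₂

theorem daggerPairs_countable : daggerPairs.Countable := by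
  refine (HereditarilyLindelofSpace.isLindelof daggerPairs).countable_of_isDiscrete
    (isDiscrete_iff_nhdsNE.2 fun p hp => ?_)
  rw [← disjoint_iff, Filter.disjoint_principal_right]
  filter_upwards [eventually_daggerMap_ne_zero hp] with q hq hq'
  exact hq hq'.1

theorem criticalSetDagger_countable : criticalSetDagger.Countable := by
  refine (daggerPairs_countable.image fun p => √(-(p.1 ^ 2 + p.1 * p.2 + p.2 ^ 2)).re).mono ?_
  rintro L ⟨hpos, a, b, h₁, h₂, hs⟩
  refine ⟨(a, b), ⟨?_, L ^ 2, by positivity, by exact_mod_cast hs⟩, ?_⟩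
  · simp [daggerMap, h₁, h₂]
  · simp only
    rw [← hs, ← Complex.ofReal_pow, Complex.ofReal_re, Real.sqrt_sq hpos.le]

theorem mainTheorem8 :
    criticalSetDagger.Countable ∧ criticalSetDagger.Nonempty ∧
      ∀ L : ℝ, L ∈ criticalSetStar → 2 * L ∈ criticalSetDagger :=
  ⟨criticalSetDagger_countable, criticalSetDagger_nonempty,
    fun _ => two_mul_mem_criticalSetDagger⟩
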